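/- Let $d,n\in\mathbb{N}$ with $n>d\ge 1$, and let $X_1,\dots,X_n$ be independent random variables, each uniformly distributed on $[0,1]^d$. For points $x_1,\dots,x_n\in[0,1]^d$ define the dispersion $$\operatorname{disp}(x_1,\dots,x_n):=\sup\{\lambda_d(B) : B=I_1\times\dots\times I_d,\ I_k\subseteq[0,1]\text{ intervals},\ B\cap\{x_1,\dots,x_n\}=\emptyset\},$$ where $\lambda_d$ is the $d$-dimensional Lebesgue measure. Then $$\max\left\{\frac{\log n}{9n},\ \frac{d}{2\mathrm{e}\,n}\right\}\ \le\ \mathbb{E}\bigl(\operatorname{disp}(X_1,\dots,X_n)\bigr)\ \le\ \frac{9d}{n}\,\log\left(\frac{\mathrm{e}\,n}{d}\right),$$ where $\log$ is the natural logarithm. -/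

import Mathlib

/-- An axis-parallel box `I₁ × ⋯ × I_d` inside the unit cube, with arbitrary intervals
`I_k ⊆ [0,1]` (open, closed, half-open or degenerate). -/
def IsAxisBox {d : ℕ} (B : Set (Fin d → ℝ)) : Prop :=
  ∃ I : Fin d → Set ℝ,
    (∀ k, (I k).OrdConnected ∧ I k ⊆ Set.Icc (0 : ℝ) 1) ∧ B = Set.univ.pi I

/-- The dispersion of `x₁, …, x_n`: the supremum of the Lebesgue measures of the
axis-parallel boxes in `[0,1]^d` that contain none of the points. -/
noncomputable def dispersion {d n : ℕ} (x : Fin n → Fin d → ℝ) : ℝ :=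
  sSup {v : ℝ | ∃ B : Set (Fin d → ℝ), IsAxisBox B ∧ B ∩ Set.range x = ∅ ∧
    v = (MeasureTheory.volume B).toReal}

/-!
**Upper bound.** Call the number of sets that a family of boxes cuts out of `m` points its growth
function. Give each sample point `a` and an independent copy `b` of it the weight
`1{a ∉ B} (1 + 1{b ∈ B})`. If the sample avoids `B`, the product of the weights has expectation
`(1 + λ(B)) ^ n` over the copies; on the other hand the weights of `(a, b)` and `(b, a)` add up to
at most `2`, so after a random exchange of each point with its copy the product has mean at most `1`
for each of the finitely many traces of boxes on the `2n` points. Hence `E (1 + disp) ^ n` is at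
most the growth function of the boxes at `2n`, which the Sauer–Shelah lemma bounds by
`(e n / d) ^ (2d)`, because boxes have VC dimension at most `2d`. Jensen's inequality finishes.

**Lower bounds.** Split the cube into `N ≈ 2n / log n` slabs. The events that a slab is missed by
all the points are negatively correlated and at least two of them are expected to occur, so the
second moment method yields an empty slab with probability at least `1/2`. For the bound in terms of
`d`, cut `[0, r) ^ d` at the largest coordinate of each point. This leaves an empty box of volume at
least `r ^ d ∏ i, min 1 (‖x i‖ / r)`, whose mean is explicit by independence, and
`r ^ d = (d + 1) / (n + 1)` is a good choice.
-/

open MeasureTheory ProbabilityTheory Set Filter Topology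
open scoped ENNReal

section Samples

variable {ι E : Type*}

/-- The samples `(x i)` indexed by `ι` that have no point in `B`. -/
def samplesAvoiding (ι : Type*) (B : Set E) : Set (ι → E) := univ.pi fun _ => Bᶜ

lemma mem_samplesAvoiding {B : Set E} {x : ι → E} :
    x ∈ samplesAvoiding ι B ↔ ∀ i, x i ∉ B := by
  simp [samplesAvoiding]

lemma samplesAvoiding_inter (B C : Set E) :
    samplesAvoiding ι B ∩ samplesAvoiding ι C = samplesAvoiding ι (B ∪ C) := by
  simp only [samplesAvoiding, ← pi_inter_distrib, compl_union]

variable [MeasurableSpace E]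

lemma measurableSet_samplesAvoiding [Countable ι] {B : Set E} (hB : MeasurableSet B) :
    MeasurableSet (samplesAvoiding ι B) :=
  MeasurableSet.univ_pi fun _ => hB.compl

lemma measureReal_samplesAvoiding [Fintype ι] (μ : Measure E) [IsProbabilityMeasure μ] {B : Set E}
    (hB : MeasurableSet B) :
    (Measure.pi fun _ : ι => μ).real (samplesAvoiding ι B) = (1 - μ.real B) ^ Fintype.card ι := by
  rw [← probReal_compl_eq_one_sub hB, samplesAvoiding, Measure.real, Measure.pi_pi]
  simp [Measure.real]

lemma lintegral_pi_prod_eq_pow [Fintype ι] (μ : Measure E) [IsProbabilityMeasure μ]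
    {f : E → ℝ≥0∞} (hf : Measurable f) :
    ∫⁻ x, ∏ i, f (x i) ∂(Measure.pi fun _ : ι => μ) = (∫⁻ a, f a ∂μ) ^ Fintype.card ι := by
  rw [lintegral_prod_eq_prod_lintegral_of_indepFun Finset.univ (fun i (x : ι → E) => f (x i))
    (iIndepFun_pi fun _ => hf.aemeasurable) fun i => hf.comp (measurable_pi_apply i)]
  simp_rw [(measurePreserving_eval (fun _ : ι => μ) _).lintegral_comp hf]
  simp

lemma lintegral_le_of_sum_comp_le {Γ : Type*} [Fintype Γ] [Nonempty Γ] {μ : Measure E}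
    [IsProbabilityMeasure μ] {T : Γ → E → E} (hT : ∀ g, MeasurePreserving (T g) μ μ)
    {f : E → ℝ≥0∞} (hf : Measurable f) {C : ℝ≥0∞}
    (hfC : ∀ a, ∑ g, f (T g a) ≤ Fintype.card Γ * C) : ∫⁻ a, f a ∂μ ≤ C := by
  have havg : Fintype.card Γ * ∫⁻ a, f a ∂μ = ∫⁻ a, ∑ g, f (T g a) ∂μ := by
    rw [lintegral_finsetSum (f := fun g a => f (T g a)) _ fun g _ => hf.comp (hT g).measurable]
    simp [(hT _).lintegral_comp hf]
  have hle : Fintype.card Γ * ∫⁻ a, f a ∂μ ≤ Fintype.card Γ * C := by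
    rw [havg]
    exact (lintegral_mono hfC).trans (by simp)
  exact (ENNReal.mul_le_mul_iff_right (by simp) (by simp)).1 hle

end Samples

section Symmetrization

variable {ι E F : Type*}

/-- The random sign of the symmetrization argument, as an action on pairs of samples: the `i`-th
points of the two samples are exchanged whenever `σ i` holds. -/
def swapPairs (σ : ι → Bool) (z : ι → E × E) (i : ι) : E × E :=
  (bif σ i then Prod.swap else id) (z i)

lemma swapPairs_map (f : E → F) (σ : ι → Bool) (z : ι → E × E) (i : ι) :
    swapPairs σ (fun i => Prod.map f f (z i)) i = Prod.map f f (swapPairs σ z i) := by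
  cases h : σ i <;> simp [swapPairs, h, Prod.swap]

lemma sum_prod_swapPairs {R : Type*} [CommSemiring R] [Fintype ι] [DecidableEq ι]
    (f : E × E → R) (z : ι → E × E) :
    ∑ σ : ι → Bool, ∏ i, f (swapPairs σ z i) = ∏ i, (f (z i) + f (z i).swap) := by
  have h := Finset.prod_univ_sum (fun _ : ι => (Finset.univ : Finset Bool))
    fun i b => f ((bif b then Prod.swap else id) (z i))
  rw [Fintype.piFinset_univ] at h
  simp [swapPairs, ← h, add_comm]

lemma measurePreserving_swapPairs [Fintype ι] [MeasurableSpace E] (μ : Measure E)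
    [SigmaFinite μ] (σ : ι → Bool) :
    MeasurePreserving (swapPairs σ) (Measure.pi fun _ : ι => μ.prod μ)
      (Measure.pi fun _ : ι => μ.prod μ) := by
  refine measurePreserving_pi _ _ fun i => ?_
  cases σ i
  · exact MeasurePreserving.id _
  · exact Measure.measurePreserving_swap

/-- The factor contributed by a sample point `z.1` and its independent copy `z.2` in the
symmetrization argument: it vanishes unless `z.1` avoids `B`, and it is doubled if `z.2` hits `B`,
so that it and its value at `z.swap` add up to at most `2`. -/
noncomputable def pairWeight (B : Set E) (z : E × E) : ℝ≥0∞ :=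
  Bᶜ.indicator 1 z.1 * (1 + B.indicator 1 z.2)

lemma pairWeight_preimage (f : E → F) (B : Set F) (z : E × E) :
    pairWeight (f ⁻¹' B) z = pairWeight B (Prod.map f f z) :=
  rfl

lemma pairWeight_add_swap_le (B : Set E) (z : E × E) :
    pairWeight B z + pairWeight B z.swap ≤ 2 := by
  by_cases h₁ : z.1 ∈ B <;> by_cases h₂ : z.2 ∈ B <;>
    simp [pairWeight, h₁, h₂, one_add_one_eq_two]

lemma sum_prod_pairWeight_swapPairs_le [Fintype ι] [DecidableEq ι] (B : Set E) (z : ι → E × E) :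
    ∑ σ : ι → Bool, ∏ i, pairWeight B (swapPairs σ z i) ≤ 2 ^ Fintype.card ι := by
  rw [sum_prod_swapPairs]
  exact (Finset.prod_le_prod' fun i _ => pairWeight_add_swap_le B (z i)).trans_eq (by simp)

variable [MeasurableSpace E]

lemma measurable_pairWeight {B : Set E} (hB : MeasurableSet B) : Measurable (pairWeight B) :=
  ((measurable_one.indicator hB.compl).comp measurable_fst).mul
    (((measurable_one.indicator hB).comp measurable_snd).const_add 1)

lemma lintegral_prod_pairWeight [Fintype ι] (μ : Measure E) [IsProbabilityMeasure μ] {B : Set E}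
    (hB : MeasurableSet B) {x : ι → E} (hx : x ∈ samplesAvoiding ι B) :
    ∫⁻ y, ∏ i, pairWeight B (x i, y i) ∂(Measure.pi fun _ : ι => μ) =
      (1 + μ B) ^ Fintype.card ι := by
  have hweight (y : ι → E) (i : ι) : pairWeight B (x i, y i) = 1 + B.indicator 1 (y i) := by
    simp [pairWeight, mem_samplesAvoiding.1 hx i]
  simp_rw [hweight]
  rw [lintegral_pi_prod_eq_pow μ ((measurable_one.indicator hB).const_add 1),
    lintegral_add_left measurable_const, lintegral_indicator_one hB]
  simp

end Symmetrization

section Traces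

variable {ι κ E : Type*} [Fintype ι]

open Classical in
/-- The traces of the sets `B q` on the finitely many points `z i`, each recorded as the set of
indices `i` with `z i ∈ B q`. Their number is the growth function of the family. -/
noncomputable def traces (B : κ → Set E) (z : ι → E) : Finset (Finset ι) :=
  Finset.univ.filter fun S => ∃ q, (S : Set ι) = z ⁻¹' B q

lemma mem_traces {B : κ → Set E} {z : ι → E} {S : Finset ι} :
    S ∈ traces B z ↔ ∃ q, (S : Set ι) = z ⁻¹' B q := by
  simp [traces]

lemma vcDim_traces_pi_le {δ α : Type*} [Fintype δ] [LinearOrder α] [DecidableEq ι]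
    {I : κ → δ → Set α} (hI : ∀ q k, (I q k).OrdConnected) (z : ι → δ → α) :
    (traces (fun q => univ.pi (I q)) z).vcDim ≤ 2 * Fintype.card δ := by
  refine Finset.sup_le fun A hA => ?_
  rcases A.eq_empty_or_nonempty with rfl | hne
  · simp
  choose lo hlo hlo_le using fun k => A.exists_min_image (fun p => z p k) hne
  choose hi hhi hle_hi using fun k => A.exists_max_image (fun p => z p k) hne
  -- A box containing the extreme points of `A` contains `A`, so shattering makes `A` their set.
  let W : Finset ι := Finset.univ.image lo ∪ Finset.univ.image hi
  have hWA : W ⊆ A := by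
    simp [W, Finset.union_subset_iff, Finset.image_subset_iff, hlo, hhi]
  have hWcard : W.card ≤ 2 * Fintype.card δ := by
    rw [two_mul]
    exact (Finset.card_union_le _ _).trans (add_le_add Finset.card_image_le Finset.card_image_le)
  obtain ⟨S, hS, hAS⟩ := Finset.mem_shatterer.1 hA hWA
  obtain ⟨q, hq⟩ := mem_traces.1 hS
  have hbox : ∀ p ∈ W, z p ∈ univ.pi (I q) := fun p hp => by
    have hpS : p ∈ (S : Set ι) := Finset.mem_inter.1 (hAS.symm ▸ hp) |>.2
    rwa [hq] at hpS
  have hAW : A ⊆ W := fun p hp => by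
    have hpS : p ∈ (S : Set ι) := by
      rw [hq]
      exact fun k _ => (hI q k).out (hbox (lo k) (by simp [W]) k trivial)
        (hbox (hi k) (by simp [W]) k trivial) ⟨hlo_le k p hp, hle_hi k p hp⟩
    exact hAS ▸ Finset.mem_inter.2 ⟨hp, hpS⟩
  exact (Finset.card_le_card hAW).trans hWcard

lemma card_traces_pi_le {δ α : Type*} [Fintype δ] [LinearOrder α]
    {I : κ → δ → Set α} (hI : ∀ q k, (I q k).OrdConnected) (z : ι → δ → α) :
    (traces (fun q => univ.pi (I q)) z).card ≤
      ∑ k ∈ Finset.Iic (2 * Fintype.card δ), (Fintype.card ι).choose k := by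
  classical
  exact (Finset.card_le_card_shatterer _).trans <| Finset.card_shatterer_le_sum_vcDim.trans <|
    Finset.sum_le_sum_of_subset (Finset.Iic_subset_Iic.2 (vcDim_traces_pi_le hI z))

lemma sum_iSup_prod_pairWeight_swapPairs_le [DecidableEq ι] (B : κ → Set E) (z : ι → E × E) :
    ∑ σ : ι → Bool, ⨆ q, ∏ i, pairWeight (B q) (swapPairs σ z i) ≤
      (traces B (Sum.elim (fun i => (z i).1) fun i => (z i).2)).card * 2 ^ Fintype.card ι := by
  set e : ι ⊕ ι → E := Sum.elim (fun i => (z i).1) fun i => (z i).2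
  let w : ι → (ι ⊕ ι) × (ι ⊕ ι) := fun i => (.inl i, .inr i)
  have hweight (σ : ι → Bool) (q : κ) (i : ι) :
      pairWeight (B q) (swapPairs σ z i) = pairWeight (e ⁻¹' B q) (swapPairs σ w i) := by
    rw [pairWeight_preimage, ← swapPairs_map]
    rfl
  have hsup (σ : ι → Bool) : ⨆ q, ∏ i, pairWeight (B q) (swapPairs σ z i) ≤
      ∑ S ∈ traces B e, ∏ i, pairWeight (S : Set (ι ⊕ ι)) (swapPairs σ w i) := by
    refine iSup_le fun q => ?_
    obtain ⟨S, hS⟩ : ∃ S : Finset (ι ⊕ ι), (S : Set (ι ⊕ ι)) = e ⁻¹' B q :=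
      (Set.toFinite _).exists_finset_coe
    simp_rw [hweight, ← hS]
    exact Finset.single_le_sum (f := fun S : Finset (ι ⊕ ι) =>
      ∏ i, pairWeight (S : Set (ι ⊕ ι)) (swapPairs σ w i)) (fun _ _ => zero_le)
      (mem_traces.2 ⟨q, hS⟩)
  calc ∑ σ : ι → Bool, ⨆ q, ∏ i, pairWeight (B q) (swapPairs σ z i)
      ≤ ∑ σ : ι → Bool, ∑ S ∈ traces B e, ∏ i, pairWeight (S : Set (ι ⊕ ι)) (swapPairs σ w i) :=
        Finset.sum_le_sum fun σ _ => hsup σ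
    _ = ∑ S ∈ traces B e, ∑ σ : ι → Bool, ∏ i, pairWeight (S : Set (ι ⊕ ι)) (swapPairs σ w i) :=
        Finset.sum_comm
    _ ≤ (traces B e).card * 2 ^ Fintype.card ι := by
        rw [← nsmul_eq_mul]
        exact Finset.sum_le_card_nsmul _ _ _ fun S _ => sum_prod_pairWeight_swapPairs_le _ w

end Traces

section AvoidedMass

variable {ι κ E : Type*} [MeasurableSpace E]

/-- The largest mass of a set of the family `B` that the sample `x` avoids. -/
noncomputable def avoidedMass (μ : Measure E) (B : κ → Set E) (x : ι → E) : ℝ≥0∞ :=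
  ⨆ q, (samplesAvoiding ι (B q)).indicator (fun _ => μ (B q)) x

lemma measurable_avoidedMass [Countable ι] [Countable κ] (μ : Measure E) {B : κ → Set E}
    (hB : ∀ q, MeasurableSet (B q)) : Measurable (avoidedMass (ι := ι) μ B) :=
  Measurable.iSup fun q => measurable_const.indicator (measurableSet_samplesAvoiding (hB q))

variable [Fintype ι]

lemma one_add_avoidedMass_pow_le (μ : Measure E) [IsProbabilityMeasure μ]
    {B : κ → Set E} (hB : ∀ q, MeasurableSet (B q)) (hempty : ∃ q, B q = ∅) (x : ι → E) :
    (1 + avoidedMass μ B x) ^ Fintype.card ι ≤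
      ∫⁻ y, ⨆ q, ∏ i, pairWeight (B q) (x i, y i) ∂(Measure.pi fun _ : ι => μ) := by
  have hle (q : κ) (hq : x ∈ samplesAvoiding ι (B q)) : (1 + μ (B q)) ^ Fintype.card ι ≤
      ∫⁻ y, ⨆ q, ∏ i, pairWeight (B q) (x i, y i) ∂(Measure.pi fun _ : ι => μ) := by
    rw [← lintegral_prod_pairWeight μ (hB q) hq]
    exact lintegral_mono fun y => le_iSup (fun q => ∏ i, pairWeight (B q) (x i, y i)) q
  obtain ⟨q₀, hq₀⟩ := hempty
  have : Nonempty κ := ⟨q₀⟩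
  rw [avoidedMass, ENNReal.add_iSup, ENNReal.iSup_pow]
  refine iSup_le fun q => ?_
  by_cases hq : x ∈ samplesAvoiding ι (B q)
  · simpa only [indicator_of_mem hq] using hle q hq
  · simpa [indicator_of_notMem hq, hq₀] using hle q₀ (mem_samplesAvoiding.2 (by simp [hq₀]))

lemma lintegral_one_add_avoidedMass_pow_le [Countable κ] (μ : Measure E)
    [IsProbabilityMeasure μ] {B : κ → Set E} (hB : ∀ q, MeasurableSet (B q))
    (hempty : ∃ q, B q = ∅) {C : ℕ} (hC : ∀ z : ι ⊕ ι → E, (traces B z).card ≤ C) :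
    ∫⁻ x, (1 + avoidedMass μ B x) ^ Fintype.card ι ∂(Measure.pi fun _ : ι => μ) ≤ C := by
  classical
  let f : (ι → E × E) → ℝ≥0∞ := fun z => ⨆ q, ∏ i, pairWeight (B q) (z i)
  have hf : Measurable f := Measurable.iSup fun q => Finset.measurable_fun_prod _ fun i _ =>
    (measurable_pairWeight (hB q)).comp (measurable_pi_apply i)
  have hghost : ∫⁻ z, f z ∂(Measure.pi fun _ : ι => μ.prod μ) =
      ∫⁻ x, ∫⁻ y, f (fun i => (x i, y i)) ∂(Measure.pi fun _ : ι => μ)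
        ∂(Measure.pi fun _ : ι => μ) := by
    have hpres := (measurePreserving_arrowProdEquivProdArrow E E ι (fun _ => μ) fun _ => μ).symm
    rw [← hpres.lintegral_comp hf]
    exact lintegral_prod _ (hf.comp hpres.measurable).aemeasurable
  calc ∫⁻ x, (1 + avoidedMass μ B x) ^ Fintype.card ι ∂(Measure.pi fun _ : ι => μ)
      ≤ ∫⁻ x, ∫⁻ y, f (fun i => (x i, y i)) ∂(Measure.pi fun _ : ι => μ)
        ∂(Measure.pi fun _ : ι => μ) :=
        lintegral_mono (one_add_avoidedMass_pow_le μ hB hempty)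
    _ = ∫⁻ z, f z ∂(Measure.pi fun _ : ι => μ.prod μ) := hghost.symm
    _ ≤ C := by
        refine lintegral_le_of_sum_comp_le (measurePreserving_swapPairs μ) hf fun z => ?_
        refine (sum_iSup_prod_pairWeight_swapPairs_le B z).trans ?_
        rw [mul_comm]
        simpa using mul_le_mul_right (Nat.cast_le.2 (hC _)) _

end AvoidedMass

section SecondMoment

variable {Ω κ : Type*} [MeasurableSpace Ω] {P : Measure Ω}

lemma memLp_indicator_one [IsFiniteMeasure P] {A : Set Ω} (hA : MeasurableSet A) (p : ℝ≥0∞) :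
    MemLp (A.indicator (1 : Ω → ℝ)) p P :=
  memLp_indicator_const p hA 1 (.inr (measure_ne_top P A))

variable [IsProbabilityMeasure P]

lemma covariance_indicator_one {A B : Set Ω} (hA : MeasurableSet A) (hB : MeasurableSet B) :
    cov[A.indicator 1, B.indicator 1; P] = P.real (A ∩ B) - P.real A * P.real B := by
  rw [covariance_eq_sub (memLp_indicator_one hA 2) (memLp_indicator_one hB 2),
    ← inter_indicator_one, integral_indicator_one hA, integral_indicator_one hB,
    integral_indicator_one (hA.inter hB)]

variable [Fintype κ] {A : κ → Set Ω}

lemma variance_sum_indicator_le (hA : ∀ j, MeasurableSet (A j))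
    (hcorr : Pairwise fun j l => P.real (A j ∩ A l) ≤ P.real (A j) * P.real (A l)) :
    Var[∑ j, (A j).indicator 1; P] ≤ ∑ j, P.real (A j) := by
  classical
  have hcov (j l : κ) : cov[(A j).indicator 1, (A l).indicator 1; P] ≤
      if j = l then P.real (A j) else 0 := by
    rw [covariance_indicator_one (hA j) (hA l)]
    split_ifs with hjl
    · subst hjl
      simpa using mul_self_nonneg (P.real (A j))
    · exact sub_nonpos.2 (hcorr hjl)
  rw [variance_sum fun j => memLp_indicator_one (hA j) 2]
  exact Finset.sum_le_sum fun j _ => (Finset.sum_le_sum fun l _ => hcov j l).trans_eq (by simp)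

lemma one_sub_inv_sum_le_measureReal_iUnion (hA : ∀ j, MeasurableSet (A j))
    (hcorr : Pairwise fun j l => P.real (A j ∩ A l) ≤ P.real (A j) * P.real (A l))
    (hpos : 0 < ∑ j, P.real (A j)) :
    1 - (∑ j, P.real (A j))⁻¹ ≤ P.real (⋃ j, A j) := by
  set m := ∑ j, P.real (A j)
  let Z : Ω → ℝ := ∑ j, (A j).indicator 1
  have hZ : MemLp Z 2 P := memLp_finsetSum' _ fun j _ => memLp_indicator_one (hA j) 2
  have hmean : P[Z] = m := by
    simp only [Z, Finset.sum_apply]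
    rw [integral_finsetSum _ fun j _ => (memLp_indicator_one (hA j) 1).integrable le_rfl]
    exact Finset.sum_congr rfl fun j _ => integral_indicator_one (hA j)
  have hsub : (⋃ j, A j)ᶜ ⊆ {ω | m ≤ |Z ω - P[Z]|} := fun ω hω => by
    have hZω : Z ω = 0 := by
      rw [compl_iUnion, mem_iInter] at hω
      simp only [Z, Finset.sum_apply]
      exact Finset.sum_eq_zero fun j _ => indicator_of_notMem (hω j) _
    simp [hmean, hZω, abs_of_pos hpos]
  have hvar : Var[Z; P] / m ^ 2 ≤ m⁻¹ := by
    rw [div_le_iff₀ (by positivity)]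
    exact (variance_sum_indicator_le hA hcorr).trans_eq (by simp only [m]; field_simp)
  have hcompl : P.real (⋃ j, A j)ᶜ ≤ m⁻¹ :=
    ENNReal.toReal_le_of_le_ofReal (by positivity) <| (measure_mono hsub).trans <|
      (meas_ge_le_variance_div_sq hZ hpos).trans (ENNReal.ofReal_le_ofReal hvar)
  rw [probReal_compl_eq_one_sub (MeasurableSet.iUnion hA)] at hcompl
  linarith

lemma one_sub_inv_sum_le_measureReal_iUnion_samplesAvoiding {ι E : Type*} [Fintype ι]
    [MeasurableSpace E] {μ : Measure E} [IsProbabilityMeasure μ] {S : κ → Set E}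
    (hS : ∀ j, MeasurableSet (S j)) (hdisj : Pairwise (Function.onFun Disjoint S))
    (hpos : 0 < ∑ j, (1 - μ.real (S j)) ^ Fintype.card ι) :
    1 - (∑ j, (1 - μ.real (S j)) ^ Fintype.card ι)⁻¹ ≤
      (Measure.pi fun _ : ι => μ).real (⋃ j, samplesAvoiding ι (S j)) := by
  simp_rw [← measureReal_samplesAvoiding μ (hS _)] at hpos ⊢
  refine one_sub_inv_sum_le_measureReal_iUnion
    (fun j => measurableSet_samplesAvoiding (hS j)) (fun j l hjl => ?_) hpos
  have hunion : μ.real (S j ∪ S l) = μ.real (S j) + μ.real (S l) :=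
    measureReal_union (hdisj hjl) (hS l)
  have hle : μ.real (S j) + μ.real (S l) ≤ 1 := hunion ▸ measureReal_le_one
  simp only [samplesAvoiding_inter]
  rw [measureReal_samplesAvoiding μ ((hS j).union (hS l)),
    measureReal_samplesAvoiding μ (hS j), measureReal_samplesAvoiding μ (hS l), ← mul_pow, hunion]
  refine pow_le_pow_left₀ (by linarith) ?_ _
  nlinarith [mul_nonneg (measureReal_nonneg (μ := μ) (s := S j))
    (measureReal_nonneg (μ := μ) (s := S l))]

end SecondMoment

lemma integral_le_of_integral_one_add_pow_le {Ω : Type*} [MeasurableSpace Ω] {P : Measure Ω}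
    [IsProbabilityMeasure P] {f : Ω → ℝ} (hf : AEStronglyMeasurable f P) (hf0 : ∀ ω, 0 ≤ f ω)
    (hf1 : ∀ ω, f ω ≤ 1) {n : ℕ} (hn : n ≠ 0) {C : ℝ} (hC : ∫ ω, (1 + f ω) ^ n ∂P ≤ C) :
    ∫ ω, f ω ∂P ≤ 3 / (2 * n) * Real.log C := by
  set m := ∫ ω, f ω ∂P with hm
  have hfint : Integrable f P := .of_mem_Icc 0 1 hf.aemeasurable (ae_of_all _ fun ω =>
    ⟨hf0 ω, hf1 ω⟩)
  have hm0 : 0 ≤ m := integral_nonneg hf0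
  have hm1 : m ≤ 1 := by
    simpa using integral_mono hfint (integrable_const (1 : ℝ)) hf1
  have hmean : ∫ ω, (1 + f ω) ∂P = 1 + m := by
    rw [integral_add (integrable_const _) hfint]
    simp [hm]
  have hpow : Integrable (fun ω => (1 + f ω) ^ n) P :=
    .of_mem_Icc 0 (2 ^ n) ((hf.aemeasurable.const_add 1).pow_const n) (ae_of_all _ fun ω =>
      ⟨by have := hf0 ω; positivity,
        pow_le_pow_left₀ (by linarith [hf0 ω]) (by linarith [hf1 ω]) n⟩)
  have hjensen : (1 + m) ^ n ≤ ∫ ω, (1 + f ω) ^ n ∂P := by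
    rw [← hmean]
    exact (convexOn_pow (𝕜 := ℝ) n).map_integral_le (continuous_pow n).continuousOn isClosed_Ici
      (ae_of_all _ fun ω => add_nonneg zero_le_one (hf0 ω)) ((integrable_const _).add hfint) hpow
  have hlog : n * Real.log (1 + m) ≤ Real.log C := by
    rw [← Real.log_pow]
    exact Real.log_le_log (by positivity) (hjensen.trans hC)
  have hlow : 2 / 3 * m ≤ Real.log (1 + m) := by
    refine le_trans ?_ (Real.le_log_one_add_of_nonneg hm0)
    rw [le_div_iff₀ (by positivity)]
    nlinarith
  rw [div_mul_eq_mul_div, le_div_iff₀ (by positivity)]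
  nlinarith [mul_le_mul_of_nonneg_left hlow n.cast_nonneg]

lemma sum_choose_le_pow {m D : ℕ} (hD : 0 < D) (hm : D ≤ m) :
    ((∑ k ∈ Finset.Iic D, m.choose k : ℕ) : ℝ) ≤ (Real.exp 1 * m / D) ^ D := by
  have hm0 : 0 < m := hD.trans_le hm
  have hle_one : (D : ℝ) / m ≤ 1 := div_le_one_of_le₀ (mod_cast hm) m.cast_nonneg
  have hscaled : (D / m : ℝ) ^ D * (∑ k ∈ Finset.Iic D, m.choose k : ℕ) ≤ Real.exp 1 ^ D :=
    calc (D / m : ℝ) ^ D * (∑ k ∈ Finset.Iic D, m.choose k : ℕ)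
        = ∑ k ∈ Finset.Iic D, (D / m : ℝ) ^ D * m.choose k := by
          rw [Nat.cast_sum, Finset.mul_sum]
      _ ≤ ∑ k ∈ Finset.Iic D, (D / m : ℝ) ^ k * m.choose k := by
          gcongr ∑ k ∈ _, ?_ * _ with k hk
          exact pow_le_pow_of_le_one (by positivity) hle_one (Finset.mem_Iic.1 hk)
      _ ≤ ∑ k ∈ Finset.range (m + 1), (D / m : ℝ) ^ k * m.choose k := by
          refine Finset.sum_le_sum_of_subset_of_nonneg (fun k hk => ?_) fun _ _ _ => by positivity
          exact Finset.mem_range_succ_iff.2 ((Finset.mem_Iic.1 hk).trans hm)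
      _ = (D / m + 1) ^ m := by
          simp [add_pow]
      _ ≤ Real.exp (D / m) ^ m := by
          gcongr
          exact Real.add_one_le_exp _
      _ = Real.exp 1 ^ D := by
          rw [← Real.exp_nat_mul, ← Real.exp_nat_mul]
          field_simp
  rwa [← le_div_iff₀' (by positivity), ← div_pow, div_div_eq_mul_div] at hscaled

lemma exp_neg_div_le_one_sub_inv_pow {t : ℝ} (ht : 0 < t) (n : ℕ) :
    Real.exp (-(n / t)) ≤ (1 - 1 / (t + 1)) ^ n := by
  have hbase : 1 - 1 / (t + 1) = (t⁻¹ + 1)⁻¹ := by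
    field_simp
    ring
  rw [hbase, div_eq_mul_inv, ← mul_neg, Real.exp_nat_mul, Real.exp_neg]
  gcongr
  exact Real.add_one_le_exp _

/-- The uniform distribution on the unit cube `[0,1]^d`. -/
noncomputable def cubeMeasure (d : ℕ) : Measure (Fin d → ℝ) :=
  volume.restrict (Icc 0 1)

/-- The open box whose sides have rational endpoints `(q k).1` and `(q k).2`; there are only
countably many such boxes, and they suffice to compute the dispersion. -/
def ratBox {d : ℕ} (q : Fin d → ℚ × ℚ) : Set (Fin d → ℝ) :=
  univ.pi fun k => Ioo ((q k).1 : ℝ) (q k).2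

section Cube

variable {d : ℕ}

lemma cubeMeasure_eq_pi (d : ℕ) :
    cubeMeasure d = Measure.pi fun _ => volume.restrict (Icc (0 : ℝ) 1) := by
  rw [cubeMeasure, ← pi_univ_Icc, volume_pi, Measure.restrict_pi_pi]
  rfl

instance : IsProbabilityMeasure (cubeMeasure d) :=
  ⟨by simp [cubeMeasure, Real.volume_Icc_pi]⟩

lemma ae_pi_cubeMeasure_nonneg (d n : ℕ) :
    ∀ᵐ x ∂(Measure.pi fun _ : Fin n => cubeMeasure d), ∀ i, 0 ≤ x i :=
  ae_all_iff.2 fun i =>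
    (measurePreserving_eval (fun _ : Fin n => cubeMeasure d) i).quasiMeasurePreserving.ae <|
      (ae_restrict_mem measurableSet_Icc).mono fun _ ha => ha.1

lemma cubeMeasure_real_closedBall_zero {t : ℝ} (ht0 : 0 ≤ t) (ht1 : t ≤ 1) :
    (cubeMeasure d).real (Metric.closedBall 0 t) = t ^ d := by
  have hside : Icc (-t) t ∩ Icc 0 1 = Icc 0 t := by
    rw [Icc_inter_Icc, max_eq_right (neg_nonpos.2 ht0), min_eq_left ht1]
  rw [closedBall_pi _ ht0, cubeMeasure_eq_pi, Measure.real, Measure.pi_pi]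
  simp [Real.closedBall_eq_Icc, hside, ht0]

lemma measurableSet_ratBox (q : Fin d → ℚ × ℚ) : MeasurableSet (ratBox q) :=
  MeasurableSet.univ_pi fun _ => measurableSet_Ioo

lemma card_traces_ratBox_le {m : ℕ} (hd : 1 ≤ d) (hm : d ≤ m) (z : Fin m ⊕ Fin m → Fin d → ℝ) :
    (traces ratBox z).card ≤ (Real.exp 1 * m / d) ^ (2 * d) := by
  have hcard : (traces ratBox z).card ≤ ∑ k ∈ Finset.Iic (2 * d), (2 * m).choose k := by
    have h := card_traces_pi_le (I := fun (q : Fin d → ℚ × ℚ) k => Ioo ((q k).1 : ℝ) (q k).2)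
      (fun _ _ => ordConnected_Ioo) z
    rwa [Fintype.card_sum, Fintype.card_fin, Fintype.card_fin, ← two_mul] at h
  refine (Nat.cast_le.2 hcard).trans ((sum_choose_le_pow (by lia) (by lia)).trans_eq ?_)
  push_cast
  field_simp

end Cube

section AxisBox

lemma exists_rat_Ioo_tendsto_volume {I : Set ℝ} (hI : I.OrdConnected)
    (hbdd : Bornology.IsBounded I) :
    ∃ q : ℕ → ℚ × ℚ, (∀ m, Ioo ((q m).1 : ℝ) (q m).2 ⊆ I) ∧
      Tendsto (fun m => volume (Ioo ((q m).1 : ℝ) (q m).2)) atTop (𝓝 (volume I)) := by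
  rcases I.eq_empty_or_nonempty with rfl | hne
  · exact ⟨0, by simp⟩
  have hinner : Ioo (sInf I) (sSup I) ⊆ I :=
    IsConnected.Ioo_csInf_csSup_subset ⟨hne, hI.isPreconnected⟩ hbdd.bddBelow hbdd.bddAbove
  have hvol : volume I = ENNReal.ofReal (sSup I - sInf I) :=
    le_antisymm (Real.volume_Icc ▸ measure_mono hbdd.subset_Icc_sInf_sSup)
      (Real.volume_Ioo ▸ measure_mono hinner)
  obtain ⟨a, -, ha, ha_lim⟩ := Real.exists_seq_rat_strictAnti_tendsto (sInf I)
  obtain ⟨b, -, hb, hb_lim⟩ := Real.exists_seq_rat_strictMono_tendsto (sSup I)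
  refine ⟨fun m => (a m, b m), fun m => (Ioo_subset_Ioo (ha m).le (hb m).le).trans hinner, ?_⟩
  simp_rw [hvol, Real.volume_Ioo]
  exact ENNReal.tendsto_ofReal (hb_lim.sub ha_lim)

variable {d n : ℕ} {B : Set (Fin d → ℝ)} {x : Fin n → Fin d → ℝ}

lemma isAxisBox_pi_inter_Icc {I : Fin d → Set ℝ} (hI : ∀ k, (I k).OrdConnected) :
    IsAxisBox (univ.pi I ∩ Icc 0 1) :=
  ⟨fun k => I k ∩ Icc 0 1, fun k => ⟨(hI k).inter ordConnected_Icc, inter_subset_right⟩, by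
    rw [← pi_univ_Icc, ← pi_inter_distrib]
    rfl⟩

lemma IsAxisBox.subset_Icc (hB : IsAxisBox B) : B ⊆ Icc 0 1 := by
  obtain ⟨I, hI, rfl⟩ := hB
  rw [← pi_univ_Icc]
  exact pi_mono fun k _ => (hI k).2

lemma IsAxisBox.measureReal_le_one (hB : IsAxisBox B) : volume.real B ≤ 1 :=
  (measureReal_mono hB.subset_Icc (by simp [Real.volume_Icc_pi])).trans
    (by simp [Measure.real, Real.volume_Icc_pi])

lemma IsAxisBox.exists_ratBox_tendsto_volume (hB : IsAxisBox B) :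
    ∃ q : ℕ → Fin d → ℚ × ℚ, (∀ m, ratBox (q m) ⊆ B) ∧
      Tendsto (fun m => cubeMeasure d (ratBox (q m))) atTop (𝓝 (volume B)) := by
  have hcube := hB.subset_Icc
  obtain ⟨I, hI, rfl⟩ := hB
  have hbdd (k : Fin d) : Bornology.IsBounded (I k) := (Metric.isBounded_Icc 0 1).subset (hI k).2
  choose q hqI hq_lim using fun k => exists_rat_Ioo_tendsto_volume (hI k).1 (hbdd k)
  have hsub (m : ℕ) : ratBox (fun k => q k m) ⊆ univ.pi I := pi_mono fun k _ => hqI k m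
  refine ⟨fun m k => q k m, hsub, ?_⟩
  simp_rw [cubeMeasure, Measure.restrict_eq_self _ ((hsub _).trans hcube), ratBox, volume_pi_pi]
  exact ENNReal.tendsto_finsetProd_of_ne_top _ (fun k _ => hq_lim k)
    fun k _ => (hbdd k).measure_lt_top.ne

lemma IsAxisBox.measureReal_le_dispersion (hB : IsAxisBox B)
    (hx : x ∈ samplesAvoiding (Fin n) B) : volume.real B ≤ dispersion x := by
  refine le_csSup ⟨1, ?_⟩ ⟨B, hB, ?_, rfl⟩
  · rintro v ⟨B', hB', -, rfl⟩
    exact hB'.measureReal_le_one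
  · exact disjoint_iff_inter_eq_empty.1 <| disjoint_right.2 <|
      forall_mem_range.2 (mem_samplesAvoiding.1 hx)

lemma measureReal_pi_le_dispersion {I : Fin d → Set ℝ} (hI : ∀ k, (I k).OrdConnected)
    (hx : x ∈ samplesAvoiding (Fin n) (univ.pi I)) :
    (cubeMeasure d).real (univ.pi I) ≤ dispersion x := by
  rw [cubeMeasure, measureReal_restrict_apply' measurableSet_Icc]
  exact (isAxisBox_pi_inter_Icc hI).measureReal_le_dispersion <|
    mem_samplesAvoiding.2 fun i hi => mem_samplesAvoiding.1 hx i hi.1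

lemma dispersion_nonneg (x : Fin n → Fin d → ℝ) : 0 ≤ dispersion x :=
  Real.sSup_nonneg (by rintro v ⟨B, -, -, rfl⟩; exact ENNReal.toReal_nonneg)

lemma dispersion_le_one (x : Fin n → Fin d → ℝ) : dispersion x ≤ 1 :=
  Real.sSup_le (by rintro v ⟨B, hB, -, rfl⟩; exact hB.measureReal_le_one) zero_le_one

lemma ofReal_dispersion_eq_avoidedMass (x : Fin n → Fin d → ℝ) :
    ENNReal.ofReal (dispersion x) = avoidedMass (cubeMeasure d) ratBox x := by
  refine le_antisymm ?_ (iSup_le fun q => ?_)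
  · have hfinite : avoidedMass (cubeMeasure d) ratBox x ≠ ⊤ :=
      ne_top_of_le_ne_top ENNReal.one_ne_top <| iSup_le fun q =>
        indicator_le (fun _ _ => prob_le_one) x
    refine ENNReal.ofReal_le_of_le_toReal (Real.sSup_le ?_ ENNReal.toReal_nonneg)
    rintro v ⟨B, hB, hBx, rfl⟩
    obtain ⟨q, hqB, hq_lim⟩ := hB.exists_ratBox_tendsto_volume
    refine ENNReal.toReal_mono hfinite (le_of_tendsto' hq_lim fun m => ?_)
    have hx : x ∈ samplesAvoiding (Fin n) (ratBox (q m)) := mem_samplesAvoiding.2 fun i hi =>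
      notMem_empty (x i) (hBx ▸ ⟨hqB m hi, mem_range_self i⟩)
    exact (indicator_of_mem hx fun _ => cubeMeasure d (ratBox (q m))).ge.trans
      (le_iSup (fun q => (samplesAvoiding (Fin n) (ratBox q)).indicator
        (fun _ => cubeMeasure d (ratBox q)) x) (q m))
  · by_cases hq : x ∈ samplesAvoiding (Fin n) (ratBox q)
    · rw [indicator_of_mem hq, ← ofReal_measureReal]
      exact ENNReal.ofReal_le_ofReal (measureReal_pi_le_dispersion (fun _ => ordConnected_Ioo) hq)
    · simp [indicator_of_notMem hq]

lemma measurable_dispersion : Measurable (dispersion : (Fin n → Fin d → ℝ) → ℝ) := by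
  have h := (measurable_avoidedMass (ι := Fin n) (cubeMeasure d)
    measurableSet_ratBox).ennreal_toReal
  simpa only [← ofReal_dispersion_eq_avoidedMass, ENNReal.toReal_ofReal (dispersion_nonneg _)]
    using h

lemma integrable_dispersion (ν : Measure (Fin n → Fin d → ℝ)) [IsFiniteMeasure ν] :
    Integrable dispersion ν :=
  .of_mem_Icc 0 1 measurable_dispersion.aemeasurable <|
    ae_of_all _ fun x => ⟨dispersion_nonneg x, dispersion_le_one x⟩

end AxisBox

section UpperBound

variable {d n : ℕ}

lemma integral_one_add_dispersion_pow_le (hd : 1 ≤ d) (hn : d ≤ n) :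
    ∫ x, (1 + dispersion x) ^ n ∂(Measure.pi fun _ : Fin n => cubeMeasure d) ≤
      (Real.exp 1 * n / d) ^ (2 * d) := by
  have hempty : ratBox (0 : Fin d → ℚ × ℚ) = ∅ := univ_pi_eq_empty (i := ⟨0, hd⟩) (by simp)
  have hgrowth (z : Fin n ⊕ Fin n → Fin d → ℝ) :
      (traces ratBox z).card ≤ ⌊(Real.exp 1 * n / d) ^ (2 * d)⌋₊ :=
    Nat.le_floor (card_traces_ratBox_le hd hn z)
  have hpow (x : Fin n → Fin d → ℝ) : ENNReal.ofReal ((1 + dispersion x) ^ n) =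
      (1 + avoidedMass (cubeMeasure d) ratBox x) ^ Fintype.card (Fin n) := by
    have h0 := dispersion_nonneg x
    rw [← ofReal_dispersion_eq_avoidedMass, ENNReal.ofReal_pow (by positivity),
      ENNReal.ofReal_add zero_le_one h0, ENNReal.ofReal_one, Fintype.card_fin]
  rw [integral_eq_lintegral_of_nonneg_ae
    (ae_of_all _ fun x => pow_nonneg (add_nonneg zero_le_one (dispersion_nonneg x)) n)
    ((measurable_dispersion.const_add 1).pow_const n).aestronglyMeasurable]
  simp_rw [hpow]
  refine ENNReal.toReal_le_of_le_ofReal (by positivity) ?_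
  refine (lintegral_one_add_avoidedMass_pow_le (cubeMeasure d) measurableSet_ratBox ⟨0, hempty⟩
    hgrowth).trans ?_
  rw [← ENNReal.ofReal_natCast]
  exact ENNReal.ofReal_le_ofReal (Nat.floor_le (by positivity))

lemma integral_dispersion_le (hd : 1 ≤ d) (hn : d ≤ n) :
    ∫ x, dispersion x ∂(Measure.pi fun _ : Fin n => cubeMeasure d) ≤
      3 * d / n * Real.log (Real.exp 1 * n / d) := by
  refine (integral_le_of_integral_one_add_pow_le measurable_dispersion.aestronglyMeasurable
    dispersion_nonneg dispersion_le_one (by lia)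
    (integral_one_add_dispersion_pow_le hd hn)).trans_eq ?_
  rw [Real.log_pow]
  push_cast
  field_simp

end UpperBound

section LargestCoordinate

variable {d n : ℕ} {x : Fin n → Fin d → ℝ}

lemma prod_le_dispersion {b : Fin d → ℝ} (hb0 : ∀ k, 0 ≤ b k) (hb1 : ∀ k, b k ≤ 1)
    (hx : ∀ i, ∃ k, b k ≤ x i k) : ∏ k, b k ≤ dispersion x := by
  have hbox : IsAxisBox (univ.pi fun k => Ico 0 (b k)) :=
    ⟨_, fun k => ⟨ordConnected_Ico, Ico_subset_Icc_self.trans (Icc_subset_Icc_right (hb1 k))⟩, rfl⟩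
  have hvol : volume.real (univ.pi fun k => Ico 0 (b k)) = ∏ k, b k := by
    simp [Measure.real, Real.volume_pi_Ico_toReal hb0]
  rw [← hvol]
  refine hbox.measureReal_le_dispersion (mem_samplesAvoiding.2 fun i hi => ?_)
  obtain ⟨k, hk⟩ := hx i
  exact (hi k trivial).2.not_ge hk

lemma pow_mul_prod_min_norm_le_dispersion (hd : 1 ≤ d) {r : ℝ} (hr0 : 0 < r) (hr1 : r ≤ 1)
    (hx : ∀ i, 0 ≤ x i) : r ^ d * ∏ i, min 1 (‖x i‖ / r) ≤ dispersion x := by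
  classical
  have : Nonempty (Fin d) := ⟨⟨0, hd⟩⟩
  have hmin0 (i : Fin n) : 0 ≤ min 1 (‖x i‖ / r) := by positivity
  have hmin1 (i : Fin n) : min 1 (‖x i‖ / r) ≤ 1 := min_le_left _ _
  choose κ hκ using fun i => (IsGreatest.pi_norm (x i)).1
  -- The side `[0, r)` in direction `k` is cut once for each point whose largest coordinate is `k`.
  let b : Fin d → ℝ := fun k => r * ∏ i with κ i = k, min 1 (‖x i‖ / r)
  have hb0 (k : Fin d) : 0 ≤ b k := mul_nonneg hr0.le (Finset.prod_nonneg fun i _ => hmin0 i)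
  have hb1 (k : Fin d) : b k ≤ 1 := mul_le_one₀ hr1 (Finset.prod_nonneg fun i _ => hmin0 i)
    (Finset.prod_le_one (fun i _ => hmin0 i) fun i _ => hmin1 i)
  have hprod : ∏ k, b k = r ^ d * ∏ i, min 1 (‖x i‖ / r) := by
    simp only [b]
    rw [Finset.prod_mul_distrib, Finset.prod_fiberwise]
    simp
  rw [← hprod]
  refine prod_le_dispersion hb0 hb1 fun i => ⟨κ i, ?_⟩
  calc b (κ i) ≤ r * min 1 (‖x i‖ / r) := by
        refine mul_le_mul_of_nonneg_left ?_ hr0.le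
        have hi : i ∈ Finset.univ.filter fun j => κ j = κ i := by simp
        rw [← Finset.mul_prod_erase _ _ hi]
        exact mul_le_of_le_one_right (hmin0 i)
          (Finset.prod_le_one (fun j _ => hmin0 j) fun j _ => hmin1 j)
    _ ≤ r * (‖x i‖ / r) := mul_le_mul_of_nonneg_left (min_le_right _ _) hr0.le
    _ = ‖x i‖ := mul_div_cancel₀ _ hr0.ne'
    _ = x i (κ i) := (hκ i).symm.trans (Real.norm_of_nonneg (hx i (κ i)))

lemma cubeMeasure_real_lt_min_norm {r t : ℝ} (hr0 : 0 < r) (hr1 : r ≤ 1) (ht : 0 < t) :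
    (cubeMeasure d).real {a | t < min 1 (‖a‖ / r)} =
      (Ioo (0 : ℝ) 1).indicator (fun t => 1 - r ^ d * t ^ d) t := by
  by_cases ht1 : t < 1
  · have hcompl : {a : Fin d → ℝ | t < min 1 (‖a‖ / r)} = (Metric.closedBall 0 (r * t))ᶜ := by
      ext a
      simp [ht1, lt_div_iff₀ hr0, mul_comm]
    rw [indicator_of_mem (mem_Ioo.2 ⟨ht, ht1⟩), hcompl,
      probReal_compl_eq_one_sub Metric.isClosed_closedBall.measurableSet,
      cubeMeasure_real_closedBall_zero (by positivity) (mul_le_one₀ hr1 ht.le ht1.le), mul_pow]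
  · simp [ht1]

lemma integral_min_norm {r : ℝ} (hr0 : 0 < r) (hr1 : r ≤ 1) :
    ∫ a, min 1 (‖a‖ / r) ∂(cubeMeasure d) = 1 - r ^ d / (d + 1) := by
  have hmin0 (a : Fin d → ℝ) : 0 ≤ min 1 (‖a‖ / r) := by positivity
  have hint : Integrable (fun a : Fin d → ℝ => min 1 (‖a‖ / r)) (cubeMeasure d) :=
    .of_mem_Icc 0 1 (by fun_prop) (ae_of_all _ fun a => ⟨hmin0 a, min_le_left _ _⟩)
  rw [hint.integral_eq_integral_meas_lt (ae_of_all _ hmin0),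
    setIntegral_congr_fun measurableSet_Ioi fun t ht => cubeMeasure_real_lt_min_norm hr0 hr1 ht,
    setIntegral_indicator measurableSet_Ioo, inter_eq_self_of_subset_right Ioo_subset_Ioi_self,
    ← integral_Ioc_eq_integral_Ioo, ← intervalIntegral.integral_of_le zero_le_one,
    intervalIntegral.integral_sub (by simp) (by apply Continuous.intervalIntegrable; fun_prop),
    intervalIntegral.integral_const, intervalIntegral.integral_const_mul, integral_pow,
    zero_pow d.succ_ne_zero, smul_eq_mul]
  ring

lemma mul_one_sub_div_pow_le_integral_dispersion (hd : 1 ≤ d) (n : ℕ) {s : ℝ} (hs0 : 0 < s)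
    (hs1 : s ≤ 1) : s * (1 - s / (d + 1)) ^ n ≤
      ∫ x, dispersion x ∂(Measure.pi fun _ : Fin n => cubeMeasure d) := by
  let r : ℝ := s ^ (d : ℝ)⁻¹
  have hr0 : 0 < r := Real.rpow_pos_of_pos hs0 _
  have hr1 : r ≤ 1 := Real.rpow_le_one hs0.le hs1 (by positivity)
  have hrs : r ^ d = s := Real.rpow_inv_natCast_pow hs0.le (by lia)
  calc s * (1 - s / (d + 1)) ^ n
      = ∫ x, r ^ d * ∏ i, min 1 (‖x i‖ / r) ∂(Measure.pi fun _ : Fin n => cubeMeasure d) := by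
        rw [integral_const_mul,
          integral_fintype_prod_eq_pow (𝕜 := ℝ) (fun a : Fin d → ℝ => min 1 (‖a‖ / r)),
          integral_min_norm hr0 hr1, hrs, Fintype.card_fin]
    _ ≤ ∫ x, dispersion x ∂(Measure.pi fun _ : Fin n => cubeMeasure d) :=
        integral_mono_of_nonneg (ae_of_all _ fun x => by positivity) (integrable_dispersion _) <|
          (ae_pi_cubeMeasure_nonneg d n).mono fun x hx =>
            pow_mul_prod_min_norm_le_dispersion hd hr0 hr1 hx

lemma div_le_integral_dispersion (hd : 1 ≤ d) (hn : d ≤ n) :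
    (d : ℝ) / (2 * Real.exp 1 * n) ≤
      ∫ x, dispersion x ∂(Measure.pi fun _ : Fin n => cubeMeasure d) := by
  have hn0 : (0 : ℝ) < n := by exact_mod_cast (by lia : 0 < n)
  have hdn : (d : ℝ) ≤ n := by exact_mod_cast hn
  have hs1 : ((d : ℝ) + 1) / (n + 1) ≤ 1 := div_le_one_of_le₀ (by linarith) (by positivity)
  have hexp : (Real.exp 1)⁻¹ ≤ (1 - (d + 1) / (n + 1) / (d + 1 : ℝ)) ^ n := by
    rw [div_right_comm, div_self (by positivity), ← Real.exp_neg]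
    simpa [hn0.ne'] using exp_neg_div_le_one_sub_inv_pow hn0 n
  have hd2n : (d : ℝ) / (2 * n) ≤ (d + 1) / (n + 1) := by
    rw [div_le_div_iff₀ (by positivity) (by positivity)]
    nlinarith
  calc (d : ℝ) / (2 * Real.exp 1 * n) = d / (2 * n) * (Real.exp 1)⁻¹ := by
        field_simp
    _ ≤ (d + 1) / (n + 1) * (1 - (d + 1) / (n + 1) / (d + 1 : ℝ)) ^ n := by
        gcongr
    _ ≤ ∫ x, dispersion x ∂(Measure.pi fun _ : Fin n => cubeMeasure d) :=
        mul_one_sub_div_pow_le_integral_dispersion hd n (by positivity) hs1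

end LargestCoordinate

section Slabs

variable {d n N : ℕ}

/-- The slab of points of `ℝ^d` whose `k`-th coordinate lies in `[j / N, (j + 1) / N)`. -/
def slab (N : ℕ) (k : Fin d) (j : Fin N) : Set (Fin d → ℝ) :=
  Function.eval k ⁻¹' Ico ((j : ℝ) / N) ((j + 1) / N)

lemma measurableSet_slab (k : Fin d) (j : Fin N) : MeasurableSet (slab N k j) :=
  measurable_pi_apply k measurableSet_Ico

lemma pairwise_disjoint_slab (k : Fin d) : Pairwise (Function.onFun Disjoint (slab N k)) := by
  have hle (j l : Fin N) (a : Fin d → ℝ) (hj : a ∈ slab N k j) (hl : a ∈ slab N k l) : j ≤ l := by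
    have hN : (0 : ℝ) < N := by exact_mod_cast j.pos
    have hlt : (j : ℝ) / N < (l + 1) / N := hj.1.trans_lt hl.2
    rw [div_lt_div_iff_of_pos_right hN] at hlt
    exact Nat.lt_succ_iff.1 (by exact_mod_cast hlt)
  exact fun j l hjl => disjoint_left.2 fun a hj hl =>
    hjl ((hle j l a hj hl).antisymm (hle l j a hl hj))

lemma cubeMeasure_real_slab (k : Fin d) (j : Fin N) :
    (cubeMeasure d).real (slab N k j) = 1 / N := by
  have hN : (0 : ℝ) < N := by exact_mod_cast j.pos
  have hj : (j : ℝ) + 1 ≤ N := by exact_mod_cast j.isLt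
  have hsub : Ico ((j : ℝ) / N) ((j + 1) / N) ⊆ Icc 0 1 :=
    Ico_subset_Icc_self.trans (Icc_subset_Icc (by positivity) ((div_le_one hN).2 hj))
  have : IsProbabilityMeasure (volume.restrict (Icc (0 : ℝ) 1)) := ⟨by simp⟩
  rw [cubeMeasure_eq_pi, slab, (measurePreserving_eval _ k).measureReal_preimage
    measurableSet_Ico.nullMeasurableSet, measureReal_restrict_apply' measurableSet_Icc,
    inter_eq_self_of_subset_left hsub, Real.volume_real_Ico_of_le (by gcongr; linarith)]
  ring

lemma one_div_le_dispersion {x : Fin n → Fin d → ℝ} {k : Fin d} {j : Fin N}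
    (hx : x ∈ samplesAvoiding (Fin n) (slab N k j)) : 1 / N ≤ dispersion x := by
  have hslab : slab N k j =
      univ.pi (Function.update (fun _ => univ) k (Ico ((j : ℝ) / N) ((j + 1 : ℝ) / N))) :=
    (univ_pi_update_univ k _).symm
  have hsides (l : Fin d) : (Function.update (fun _ => univ) k
      (Ico ((j : ℝ) / N) ((j + 1 : ℝ) / N)) l).OrdConnected := by
    rcases eq_or_ne l k with rfl | hl
    · simpa using ordConnected_Ico
    · simpa [hl] using ordConnected_univ
  rw [← cubeMeasure_real_slab k j, hslab]
  exact measureReal_pi_le_dispersion hsides (hslab ▸ hx)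

lemma one_div_mul_one_sub_le_integral_dispersion (hd : 1 ≤ d) (n : ℕ) (hN : 2 ≤ N) :
    1 / N * (1 - (N * (1 - 1 / (N : ℝ)) ^ n)⁻¹) ≤
      ∫ x, dispersion x ∂(Measure.pi fun _ : Fin n => cubeMeasure d) := by
  let k : Fin d := ⟨0, hd⟩
  have hN' : (1 : ℝ) < N := by exact_mod_cast hN
  have hsum : ∑ j : Fin N, (1 - (cubeMeasure d).real (slab N k j)) ^ Fintype.card (Fin n) =
      N * (1 - 1 / (N : ℝ)) ^ n := by
    simp [cubeMeasure_real_slab]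
  have hpos : 0 < N * (1 - 1 / (N : ℝ)) ^ n :=
    mul_pos (by linarith) (pow_pos (sub_pos.2 ((div_lt_one (by linarith)).2 hN')) n)
  have hmissed := one_sub_inv_sum_le_measureReal_iUnion_samplesAvoiding (ι := Fin n)
    (measurableSet_slab k) (pairwise_disjoint_slab k) (hsum ▸ hpos)
  have hsub : (⋃ j, samplesAvoiding (Fin n) (slab N k j)) ⊆ {x | 1 / N ≤ dispersion x} :=
    iUnion_subset fun j x hx => one_div_le_dispersion hx
  rw [hsum] at hmissed
  calc 1 / N * (1 - (N * (1 - 1 / (N : ℝ)) ^ n)⁻¹)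
      ≤ 1 / N * (Measure.pi fun _ : Fin n => cubeMeasure d).real {x | 1 / N ≤ dispersion x} := by
        gcongr
        exact hmissed.trans (measureReal_mono hsub)
    _ ≤ ∫ x, dispersion x ∂(Measure.pi fun _ : Fin n => cubeMeasure d) :=
        mul_meas_ge_le_integral_of_nonneg (ae_of_all _ dispersion_nonneg)
          (integrable_dispersion _) _

lemma two_le_mul_one_sub_inv_pow {t : ℝ} {n : ℕ} (hn : 1 < n) (ht : 2 * n / Real.log n ≤ t) :
    2 ≤ (t + 1) * (1 - 1 / (t + 1)) ^ n := by
  have hn1 : (1 : ℝ) < n := by exact_mod_cast hn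
  have hlog : 0 < Real.log n := Real.log_pos hn1
  have ht0 : 0 < t := lt_of_lt_of_le (by positivity) ht
  have hexp : Real.exp (-(Real.log n / 2)) ≤ (1 - 1 / (t + 1)) ^ n := by
    refine le_trans ?_ (exp_neg_div_le_one_sub_inv_pow ht0 n)
    rw [div_le_iff₀ hlog] at ht
    gcongr Real.exp (-?_)
    rw [div_le_div_iff₀ ht0 two_pos]
    linarith
  have hsqrt : Real.log n ≤ Real.exp (Real.log n / 2) := by
    nlinarith [Real.exp_one_mul_le_exp (x := Real.log n / 2), Real.exp_one_gt_two]
  have hexp_half : Real.exp (Real.log n / 2) = n * Real.exp (-(Real.log n / 2)) := by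
    nth_rw 2 [← Real.exp_log (zero_lt_one.trans hn1)]
    rw [← Real.exp_add]
    ring_nf
  calc (2 : ℝ) ≤ 2 * (Real.exp (Real.log n / 2) / Real.log n) :=
        le_mul_of_one_le_right two_pos.le ((one_le_div hlog).2 hsqrt)
    _ = 2 * n / Real.log n * Real.exp (-(Real.log n / 2)) := by
        rw [hexp_half]
        ring
    _ ≤ (t + 1) * (1 - 1 / (t + 1)) ^ n := by
        gcongr
        linarith

lemma log_div_le_integral_dispersion (hd : 1 ≤ d) (hn : 1 < n) :
    Real.log n / (9 * n) ≤
      ∫ x, dispersion x ∂(Measure.pi fun _ : Fin n => cubeMeasure d) := by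
  have hn1 : (1 : ℝ) < n := by exact_mod_cast hn
  have hlog : 0 < Real.log n := Real.log_pos hn1
  have hlog_le : Real.log n ≤ n - 1 := Real.log_le_sub_one_of_pos (by linarith)
  set M : ℕ := ⌈2 * n / Real.log n⌉₊
  have hM0 : 0 < M := Nat.ceil_pos.2 (by positivity)
  have hM : (M + 1 : ℝ) * Real.log n ≤ 4 * n := by
    have hM_lt : (M : ℝ) < 2 * n / Real.log n + 1 := Nat.ceil_lt_add_one (by positivity)
    calc (M + 1 : ℝ) * Real.log n ≤ (2 * n / Real.log n + 2) * Real.log n := by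
          gcongr ?_ * _
          linarith
      _ = 2 * n + 2 * Real.log n := by field_simp
      _ ≤ 4 * n := by linarith
  have hmean := two_le_mul_one_sub_inv_pow hn (Nat.le_ceil (2 * n / Real.log n))
  have hhalf : 1 / 2 ≤ 1 - ((M + 1) * (1 - 1 / (M + 1 : ℝ)) ^ n)⁻¹ := by
    linarith [inv_anti₀ two_pos hmean]
  calc Real.log n / (9 * n) ≤ 1 / (M + 1 : ℝ) * (1 / 2) := by
        rw [div_mul_div_comm, div_le_div_iff₀ (by positivity) (by positivity)]
        linarith
    _ ≤ 1 / (M + 1 : ℝ) * (1 - ((M + 1) * (1 - 1 / (M + 1 : ℝ)) ^ n)⁻¹) := by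
        gcongr
    _ ≤ ∫ x, dispersion x ∂(Measure.pi fun _ : Fin n => cubeMeasure d) := by
        simpa using one_div_mul_one_sub_le_integral_dispersion hd n (N := M + 1) (by lia)

end Slabs

lemma map_eq_pi_cubeMeasure {Ω : Type*} [MeasurableSpace Ω] {P : Measure Ω}
    [IsProbabilityMeasure P] {d n : ℕ} {X : Fin n → Ω → Fin d → ℝ} (hX : ∀ i, Measurable (X i))
    (hindep : iIndepFun X P)
    (hunif : ∀ i, pdf.IsUniform (X i) (univ.pi fun _ => Icc (0 : ℝ) 1) P volume) :
    P.map (fun ω i => X i ω) = Measure.pi fun _ : Fin n => cubeMeasure d := by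
  have hlaw (i : Fin n) : P.map (X i) = cubeMeasure d := by
    rw [hunif i, pi_univ_Icc, ProbabilityTheory.cond, cubeMeasure]
    simp [Real.volume_Icc_pi, Pi.zero_def, Pi.one_def]
  rw [(iIndepFun_iff_map_fun_eq_pi_map fun i => (hX i).aemeasurable).1 hindep]
  simp_rw [hlaw]

theorem theorem1 {Ω : Type*} [MeasurableSpace Ω] (P : MeasureTheory.Measure Ω)
    [MeasureTheory.IsProbabilityMeasure P] (d n : ℕ) (hd : 1 ≤ d) (hn : d < n)
    (X : Fin n → Ω → (Fin d → ℝ)) (hmeas : ∀ i, Measurable (X i))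
    (hindep : ProbabilityTheory.iIndepFun X P)
    (hunif : ∀ i, MeasureTheory.pdf.IsUniform (X i)
      (Set.univ.pi fun _ : Fin d => Set.Icc (0 : ℝ) 1) P MeasureTheory.volume) :
    MeasureTheory.Integrable (fun ω => dispersion fun i => X i ω) P ∧
    max (Real.log n / (9 * n)) (d / (2 * Real.exp 1 * n))
      ≤ ∫ ω, dispersion (fun i => X i ω) ∂P ∧
    ∫ ω, dispersion (fun i => X i ω) ∂P
      ≤ 9 * d / n * Real.log (Real.exp 1 * n / d) := by
  have hXm : Measurable fun ω i => X i ω := measurable_pi_lambda _ hmeas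
  have hmean : ∫ ω, dispersion (fun i => X i ω) ∂P =
      ∫ x, dispersion x ∂(Measure.pi fun _ : Fin n => cubeMeasure d) := by
    rw [← map_eq_pi_cubeMeasure hmeas hindep hunif,
      integral_map hXm.aemeasurable measurable_dispersion.aestronglyMeasurable]
  rw [hmean]
  refine ⟨(integrable_dispersion (P.map fun ω i => X i ω)).comp_measurable hXm,
    max_le (log_div_le_integral_dispersion hd (by lia)) (div_le_integral_dispersion hd hn.le),
    (integral_dispersion_le hd hn.le).trans ?_⟩
  have hlog : 0 ≤ Real.log (Real.exp 1 * n / d) := by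
    have hd0 : (0 : ℝ) < d := by exact_mod_cast hd
    have hdn : (d : ℝ) ≤ n := by exact_mod_cast hn.le
    exact Real.log_nonneg ((one_le_div hd0).2 (by nlinarith [Real.exp_one_gt_two]))
  gcongr
  norm_num
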